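/- Let $X$ be a path-connected and locally path-connected topological space and let $\mathcal C(X)$ be the ring of continuous functions $X\to\mathbb C$. A Weierstrass polynomial of degree $n$ on $X$ is a monic $f\in\mathcal C(X)[z]$ of degree $n$ such that for every $x\in X$ the polynomial $f_x\in\mathbb C[z]$ has $n$ distinct roots. For a covering $p:Y\to X$ let $p^*f\in\mathcal C(Y)[z]$ be obtained by composing the coefficients with $p$; we say that $f$ splits in $Y$ with roots $\alpha_1,\dots,\alpha_n$ if these are $n$ distinct continuous functions $Y\to\mathbb C$ with $(p^*f)_y(\alpha_i(y))=0$ for all $y$. A splitting covering of $f$ is a path-connected covering $q:E_f\to X$ in which $f$ splits, such that for every path-connected covering $p:Y\to X$ in which $f$ splits there is a covering map $\pi:Y\to E_f$ with $q\pi=p$. Let $\beta_1,\dots,\beta_n$ be the roots of $f$ in $E_f$. The semi-topological Galois group of $f$ is $G_f=\mathrm{Aut}_{q^*\mathcal C(X)}\big(q^*\mathcal C(X)[\beta_1,\dots,\beta_n]\big)$, where $q^*\mathcal C(X)=\{\gamma\circ q:\gamma\in\mathcal C(X)\}$, and $A(E_f/X)$ is the group of homeomorphisms $\Phi$ of $E_f$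 with $q\Phi=q$. For functions $\alpha_1,\dots,\alpha_n$ on $Y$ define $\Delta:Y\to\mathbb C$ as follows. For $I=(i_1,\dots,i_{n-1})$ with $0\le i_k\le n-k$ let $\alpha^I=\alpha_1^{i_1}\cdots\alpha_{n-1}^{i_{n-1}}$ and $\sigma^I=\sigma_1^{i_1}\cdots\sigma_{n-1}^{i_{n-1}}\in S_n$, where $\sigma_k$ is the cycle $(k\;k{+}1\;\cdots\;n)$ and permutations are composed from right to left; a permutation $\sigma$ acts on monomials by $\alpha_k\mapsto\alpha_{\sigma(k)}$. Then $\Delta(y)$ is the determinant of the $n!\times n!$ matrix with entries $(\sigma^I(\alpha^J))(y)$, where the rows $I$ and the columns $J$ are listed in the same order. A ring $S$ is called $G$-Galois over a subring $R$ (in the sense of Chase--Harrison--Rosenberg), for a finite subgroup $G\subseteq\mathrm{Aut}_R(S)$, if $S^G=R$ and there are $x_1,\dots,x_m,y_1,\dots,y_m\in S$ with $\sum_i x_i\,\sigma(y_i)=\delta_{e,\sigma}$ for all $\sigma\in G$. **Theorem.** Let $f$ be a Weierstrass polynomial of degree $n$ on $X$. 1. Suppose that $f$ splits in a path-connected covering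 $p:Y\to X$ with roots $\alpha_1,\dots,\alpha_n$, and put $R=p^*\mathcal C(X)$. Then $\Delta$ vanishes nowhere and $\Delta^{-1}\in R[\alpha_1,\dots,\alpha_n]$. 2. In the situation of 1, $R[\alpha_1,\dots,\alpha_n]$ is $G_f$-Galois over $R$. That is, $R[\alpha_1,\dots,\alpha_n]$ is $\mathrm{Aut}_R(R[\alpha_1,\dots,\alpha_n])$-Galois over $R$, and for every splitting covering $q:E_f\to X$ of $f$, with roots $\beta_1,\dots,\beta_n$, there is a ring isomorphism $\Theta:q^*\mathcal C(X)[\beta_1,\dots,\beta_n]\to R[\alpha_1,\dots,\alpha_n]$ with $\Theta(\gamma\circ q)=\gamma\circ p$ for $\gamma\in\mathcal C(X)$ and $\Theta(\beta_i)=\alpha_{\tau(i)}$ for some permutation $\tau$, and $\phi\mapsto\Theta\phi\Theta^{-1}$ is a group isomorphism from $G_f$ onto $\mathrm{Aut}_R(R[\alpha_1,\dots,\alpha_n])$. 3. For every splitting covering $q:E_f\to X$ of $f$, the map $\omega:A(E_f/X)\to G_f$, $\omega(\Phi)(s)=s\circ\Phi^{-1}$, is a well-defined surjective group homomorphism. 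-/

import Mathlib

universe u

namespace SemiTopGalois

open Polynomial

section Weierstrass

variable {X Y : Type*} [TopologicalSpace X] [TopologicalSpace Y]

/-- The pullback `λ^* : C(X) → C(Y)`, `γ ↦ γ ∘ λ`, as a ring homomorphism. -/
noncomputable def pullback (l : C(Y, X)) : C(X, ℂ) →+* C(Y, ℂ) :=
  (ContinuousMap.compRightAlgHom ℂ ℂ l).toRingHom

/-- The induced pullback of polynomials `λ^* : C(X)[z] → C(Y)[z]`. -/
noncomputable def pullbackPoly (l : C(Y, X)) (f : C(X, ℂ)[X]) : C(Y, ℂ)[X] :=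
  f.map (pullback l)

/-- The complex polynomial `f_x`, for `f` in `C(X)[z]` and a point `x`. -/
noncomputable def fiberPoly (f : C(X, ℂ)[X]) (x : X) : ℂ[X] :=
  f.map (ContinuousMap.evalAlgHom ℂ ℂ x).toRingHom

/-- A Weierstrass polynomial of degree `n` on `X`: monic of degree `n`, such that each `f_x` has
`n` distinct roots. -/
structure IsWeierstrass (f : C(X, ℂ)[X]) (n : ℕ) : Prop where
  monic : f.Monic
  natDegree_eq : f.natDegree = n
  ncard_roots : ∀ x : X, {z : ℂ | (fiberPoly f x).eval z = 0}.ncard = n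

/-- A root of `f` on `X`: a continuous function `a` with `f_x(a(x)) = 0` for all `x`. -/
def IsContRoot (f : C(X, ℂ)[X]) (a : C(X, ℂ)) : Prop :=
  ∀ x : X, (fiberPoly f x).eval (a x) = 0

/-- `α_1, …, α_n` are `n` distinct roots of `f` on `X`. -/
def SplitsWithRoots {n : ℕ} (f : C(X, ℂ)[X]) (α : Fin n → C(X, ℂ)) : Prop :=
  Function.Injective α ∧ ∀ i, IsContRoot f (α i)

end Weierstrass

/-- `q : E → X` is a splitting covering of the Weierstrass polynomial `f` of degree `n`: a
path-connected covering space in which `f` splits, and over which every path-connected covering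
space `Y` of `X` in which `f` splits lies, by a covering map compatible with the projections. -/
structure IsSplittingCovering {X E : Type u} [TopologicalSpace X] [TopologicalSpace E]
    (f : C(X, ℂ)[X]) (n : ℕ) (q : C(E, X)) : Prop where
  pathConnected : PathConnectedSpace E
  isCoveringMap : IsCoveringMap q
  splits : ∃ α : Fin n → C(E, ℂ), SplitsWithRoots (pullbackPoly q f) α
  smallest : ∀ (Y : Type u) [TopologicalSpace Y] [PathConnectedSpace Y] (p : C(Y, X)),
    IsCoveringMap p →
    (∃ α : Fin n → C(Y, ℂ), SplitsWithRoots (pullbackPoly p f) α) →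
    ∃ π : C(Y, E), IsCoveringMap π ∧ q.comp π = p

section Rings

variable {X Y : Type*} [TopologicalSpace X] [TopologicalSpace Y]

/-- The subring `p^* C(X)` of `C(Y)`. -/
noncomputable def pullbackRing (p : C(Y, X)) : Subring C(Y, ℂ) :=
  (pullback p).range

/-- The ring `R[α_1, …, α_n]` with `R = p^* C(X)`. -/
noncomputable abbrev rootRing {n : ℕ} (p : C(Y, X)) (α : Fin n → C(Y, ℂ)) :
    Subalgebra (pullbackRing p) C(Y, ℂ) :=
  Algebra.adjoin (pullbackRing p) (Set.range α)

/-- The group `Aut_R(R[α_1, …, α_n])` with `R = p^* C(X)`. When `p` is the splitting covering of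
`f` and the `α_i` are the roots of `f`, this is the semi-topological Galois group `G_f`. -/
abbrev GaloisGroup {n : ℕ} (p : C(Y, X)) (α : Fin n → C(Y, ℂ)) : Type _ :=
  rootRing p α ≃ₐ[pullbackRing p] rootRing p α

/-- The group `A(Y/X)` of covering transformations of `p : Y → X`. -/
def coveringTransformations (p : C(Y, X)) : Subgroup (Y ≃ₜ Y) where
  carrier := {Φ | ∀ y, p (Φ y) = p y}
  one_mem' := fun _ => rfl
  mul_mem' := by
    intro a b ha hb y
    change p (a (b y)) = p y
    rw [ha, hb]
  inv_mem' := by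
    intro a ha y
    have h := ha (a⁻¹ y)
    rw [Homeomorph.inv_apply, Homeomorph.apply_symm_apply] at h
    rw [Homeomorph.inv_apply]
    exact h.symm

end Rings

/-- `S` is `G`-Galois over its subring `R` in the sense of Chase, Harrison and Rosenberg, for a
finite subgroup `G` of `Aut_R(S)`: `S^G = R`, and there are `x_1, …, x_m; y_1, …, y_m` in `S` with
`∑ x_i σ(y_i) = δ_{e,σ}` for all `σ` in `G`. -/
structure IsCHRGalois (R S : Type*) [CommRing R] [CommRing S] [Algebra R S]
    (G : Subgroup (S ≃ₐ[R] S)) : Prop where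
  injective : Function.Injective (algebraMap R S)
  finite : Finite G
  fixed : ∀ s : S, (∀ σ ∈ G, σ s = s) ↔ s ∈ Set.range (algebraMap R S)
  dual : ∃ (m : ℕ) (x y : Fin m → S),
    (∑ i, x i * y i = 1) ∧ ∀ σ ∈ G, σ ≠ 1 → ∑ i, x i * σ (y i) = 0

section Determinant

/-- The multi-indices `I = (i_k)`. The positions `k` are numbered from `0`, so that the bound
`0 ≤ i_k ≤ n - k` for positions numbered from `1` reads `i_k < n - k`. The last position, where
only `i_k = 0` is possible, is included for uniformity and contributes trivial factors. -/
abbrev MultiIndex (n : ℕ) : Type :=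
  (k : Fin n) → Fin (n - k)

/-- The cycle `σ_k = (k k+1 … n)` (here in `0`-based numbering `(k k+1 … n-1)`). -/
def tailCycle (n : ℕ) (k : ℕ) : Equiv.Perm (Fin n) :=
  ((List.finRange n).drop k).formPerm

/-- The permutation `σ^I = σ_1^{i_1} σ_2^{i_2} ⋯`, the product taken in this order. -/
def permOf {n : ℕ} (I : MultiIndex n) : Equiv.Perm (Fin n) :=
  (List.ofFn fun k : Fin n => tailCycle n k ^ (I k : ℕ)).prod

/-- The `n! × n!` matrix `V_n` with entries `φ_I(x_J)`, where `x_J = ∏ α_k^{j_k}` and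
`φ_I = σ^I` acts by `α_k ↦ α_{σ^I(k)}`. Rows and columns are both indexed by the multi-indices;
an enumeration of these, used for rows and columns alike, does not affect the determinant. -/
def vMatrix {S : Type*} [CommRing S] {n : ℕ} (a : Fin n → S) :
    Matrix (MultiIndex n) (MultiIndex n) S :=
  Matrix.of fun I J => ∏ k, a (permOf I k) ^ (J k : ℕ)

/-- The function `Δ(y) = det V(y)` formed from functions `α_1, …, α_n` on `Y`. -/
noncomputable def Delta {Y : Type*} [TopologicalSpace Y] {n : ℕ} (α : Fin n → C(Y, ℂ))
    (y : Y) : ℂ :=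
  (vMatrix fun i => α i y).det

end Determinant

end SemiTopGalois

/-!
Points of a covering `Y` in one fibre see the same values of the roots in different orders, and the
permutations that occur form a finite group `G`. By path lifting and the rigidity of roots (two
continuous roots of `f` that agree at one point of a connected space are equal), such a permutation
occurs at every point once it occurs at one, so `G` acts on `S = R[α_1, …, α_n]` by ring
automorphisms, and a `G`-invariant element of `S` is constant on fibres, i.e. `S ^ G = R`.

A permutation of the roots permutes the rows of the matrix `V` with determinant `Δ`, so `Δ ^ 2` is
`G`-invariant. It descends to a nowhere vanishing function on `X`, hence `Δ` is a unit of `S`, and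
the monomials `α^J` with the column of `V⁻¹` at the identity permutation are the dual bases of the
Galois condition. If `φ` is an `R`-automorphism of `S`, then evaluation at a point and its
composite with `φ` are characters of `S` with the same restriction to `S ^ G = R`, so an element of
`G` carries the kernel of one to that of the other, and by rigidity it induces `φ`. Hence
`Aut_R(S) = G`.

The image of `Y` in `X × ℂⁿ` is a covering of `X` on which `G` acts simply transitively on
fibres. Minimality identifies a splitting covering with its own image, so every element of `G` is
induced by a covering transformation.
-/

namespace SemiTopGalois

open Polynomial

section Permutations

variable {n : ℕ}

theorem tailCycle_pow_apply_self (k : Fin n) {m : ℕ} (hm : m < n - k) :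
    ((tailCycle n k ^ m) k : ℕ) = k + m := by
  have hlen : ((List.finRange n).drop k).length = n - k := by simp
  have hpow := List.formPerm_pow_apply_getElem ((List.finRange n).drop k)
    ((List.nodup_finRange n).sublist (List.drop_sublist _ _)) m 0 (by omega)
  have hhead : ((List.finRange n).drop k)[0] = k := by simp
  rw [hhead] at hpow
  rw [tailCycle, hpow]
  simp [Nat.mod_eq_of_lt hm]

theorem tailCycle_apply_of_lt {k : ℕ} {j : Fin n} (h : (j : ℕ) < k) : tailCycle n k j = j := by
  refine List.formPerm_apply_of_notMem fun hj => ?_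
  obtain ⟨i, hi, rfl⟩ := List.getElem_of_mem hj
  simp at h

/-- The tail `σ_k^{i_k} σ_{k+1}^{i_{k+1}} ⋯` of the product defining `σ^I`. -/
def tailPermOf (I : MultiIndex n) (k : ℕ) : Equiv.Perm (Fin n) :=
  ((List.ofFn fun l : Fin n => tailCycle n l ^ (I l : ℕ)).drop k).prod

theorem tailPermOf_zero (I : MultiIndex n) : tailPermOf I 0 = permOf I := rfl

theorem tailPermOf_eq_mul (I : MultiIndex n) (k : Fin n) :
    tailPermOf I k = tailCycle n k ^ (I k : ℕ) * tailPermOf I (k + 1) := by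
  rw [tailPermOf, List.drop_eq_getElem_cons (by simp), List.prod_cons, List.getElem_ofFn]
  rfl

theorem tailPermOf_apply_of_lt (I : MultiIndex n) {k : ℕ} {j : Fin n} (h : (j : ℕ) < k) :
    tailPermOf I k j = j := by
  refine (MulAction.stabilizer (Equiv.Perm (Fin n)) j).list_prod_mem fun σ hσ => ?_
  obtain ⟨i, hi, rfl⟩ := List.getElem_of_mem hσ
  rw [List.getElem_drop, List.getElem_ofFn]
  exact pow_mem (tailCycle_apply_of_lt (h.trans_le (Nat.le_add_right k i))) _

theorem tailPermOf_apply_self (I : MultiIndex n) (k : Fin n) :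
    (tailPermOf I k k : ℕ) = k + I k := by
  rw [tailPermOf_eq_mul, Equiv.Perm.mul_apply, tailPermOf_apply_of_lt I (Nat.lt_succ_self k),
    tailCycle_pow_apply_self k (I k).2]

theorem permOf_injective : Function.Injective (permOf (n := n)) := by
  intro I J hIJ
  have index_eq {k : Fin n} (h : tailPermOf I k = tailPermOf J k) : I k = J k := by
    have hI := tailPermOf_apply_self I k
    rw [h, tailPermOf_apply_self J k] at hI
    exact Fin.ext (Nat.add_left_cancel hI).symm
  have tail_eq (k : ℕ) (hk : k ≤ n) : tailPermOf I k = tailPermOf J k := by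
    induction k with
    | zero => rwa [tailPermOf_zero, tailPermOf_zero]
    | succ k ih =>
      have h := ih (Nat.le_of_succ_le hk)
      have hmul := (tailPermOf_eq_mul I ⟨k, hk⟩).symm.trans
        (h.trans (tailPermOf_eq_mul J ⟨k, hk⟩))
      rw [index_eq (k := ⟨k, hk⟩) h] at hmul
      exact mul_left_cancel hmul
  exact funext fun k => index_eq (tail_eq k k.2.le)

theorem card_multiIndex (n : ℕ) : Fintype.card (MultiIndex n) = n.factorial := by
  rw [Fintype.card_pi]
  simp only [Fintype.card_fin]
  rw [Fin.prod_univ_eq_prod_range (fun k => n - k) n, ← Nat.descFactorial_eq_prod_range,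
    Nat.descFactorial_self]

theorem permOf_bijective : Function.Bijective (permOf (n := n)) := by
  rw [Fintype.bijective_iff_injective_and_card]
  exact ⟨permOf_injective, by rw [card_multiIndex, Fintype.card_perm, Fintype.card_fin]⟩

end Permutations

section Determinants

theorem eq_zero_of_forall_sum_mul_prod_pow_eq_zero {K : Type*} [CommRing K] [IsDomain K] {n : ℕ}
    (d : Fin n → ℕ) (A : Finset K) (hd : ∀ k, d k ≤ A.card - k)
    (c : ((k : Fin n) → Fin (d k)) → K)
    (h : ∀ b : Fin n → K, Function.Injective b → (∀ k, b k ∈ A) →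
      ∑ J, c J * ∏ k, b k ^ (J k : ℕ) = 0) : c = 0 := by
  classical
  induction n generalizing A with
  | zero =>
    funext J
    rw [Subsingleton.elim J default]
    simpa using h Fin.elim0 (fun i => i.elim0) fun i => i.elim0
  | succ n ih =>
    let e := Fin.consEquiv fun k : Fin (n + 1) => Fin (d k)
    have sum_mul_pow_eq_zero (t : K) (ht : t ∈ A) (J : (k : Fin n) → Fin (d k.succ)) :
        ∑ j : Fin (d 0), c (Fin.cons j J) * t ^ (j : ℕ) = 0 := by
      refine congrFun (ih (fun k => d k.succ) (A.erase t) (fun k => ?_)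
        (fun J => ∑ j : Fin (d 0), c (Fin.cons j J) * t ^ (j : ℕ)) fun b hb hbA => ?_) J
      · have := hd k.succ
        rw [Fin.val_succ] at this
        rw [Finset.card_erase_of_mem ht]
        omega
      · have hinj : Function.Injective (Fin.cons t b : Fin (n + 1) → K) :=
          Fin.cons_injective_iff.mpr
            ⟨fun ⟨k, hk⟩ => Finset.ne_of_mem_erase (hbA k) hk, hb⟩
        rw [← h (Fin.cons t b) hinj (Fin.cases ht fun k => Finset.mem_of_mem_erase (hbA k)),
          ← e.sum_comp, Fintype.sum_prod_type, Finset.sum_comm]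
        refine Finset.sum_congr rfl fun J _ => ?_
        rw [Finset.sum_mul]
        refine Finset.sum_congr rfl fun j _ => ?_
        rw [Fin.prod_univ_succ]
        simp [e, Fin.consEquiv, mul_assoc]
    funext J
    obtain ⟨⟨j, J⟩, rfl⟩ := e.surjective J
    let nodes (i : Fin (d 0)) : K := A.equivFin.symm (Fin.castLE (hd 0) i)
    have nodes_injective : Function.Injective nodes :=
      Subtype.val_injective.comp (A.equivFin.symm.injective.comp (Fin.castLE_injective _))
    exact congrFun (Matrix.eq_zero_of_forall_index_sum_mul_pow_eq_zero nodes_injective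
      fun i => sum_mul_pow_eq_zero (nodes i) (Subtype.prop _) J) j

theorem det_vMatrix_ne_zero {K : Type*} [CommRing K] [IsDomain K] {n : ℕ} {a : Fin n → K}
    (ha : Function.Injective a) : (vMatrix a).det ≠ 0 := by
  intro hdet
  obtain ⟨c, hc, hV⟩ := Matrix.exists_mulVec_eq_zero_iff.mpr hdet
  refine hc (eq_zero_of_forall_sum_mul_prod_pow_eq_zero (fun k : Fin n => n - k)
    (Finset.univ.map ⟨a, ha⟩) (fun k => by simp) c fun b hb hbA => ?_)
  have hrange (k : Fin n) : ∃ i, a i = b k := by simpa using hbA k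
  choose s hs using hrange
  have hs_inj : Function.Injective s := fun i j hij => hb (by rw [← hs, ← hs, hij])
  obtain ⟨I, hI⟩ := permOf_bijective.2
    (Equiv.ofBijective s (Finite.injective_iff_bijective.mp hs_inj))
  rw [← Pi.zero_apply (M := fun _ => K) I, ← hV, Matrix.mulVec, dotProduct]
  refine Finset.sum_congr rfl fun J _ => ?_
  rw [mul_comm]
  simp [vMatrix, hI, hs]

theorem map_det_vMatrix {S T : Type*} [CommRing S] [CommRing T] (φ : S →+* T) {n : ℕ}
    (a : Fin n → S) : φ (vMatrix a).det = (vMatrix fun i => φ (a i)).det := by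
  rw [RingHom.map_det]
  congr 1
  ext I J
  simp [vMatrix]

theorem det_vMatrix_comp_perm_sq {S : Type*} [CommRing S] {n : ℕ} (a : Fin n → S)
    (σ : Equiv.Perm (Fin n)) : (vMatrix fun i => a (σ i)).det ^ 2 = (vMatrix a).det ^ 2 := by
  let e := Equiv.ofBijective _ (permOf_bijective (n := n))
  let ρ : Equiv.Perm (MultiIndex n) := (e.trans (Equiv.mulLeft σ)).trans e.symm
  have hsubmatrix : (vMatrix fun i => a (σ i)) = (vMatrix a).submatrix ρ id := by
    ext I J
    have hρ : permOf (ρ I) = σ * permOf I := e.apply_symm_apply _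
    simp [vMatrix, hρ]
  rw [hsubmatrix, Matrix.det_permute, mul_pow]
  rcases Int.units_eq_one_or (Equiv.Perm.sign ρ) with h | h <;> simp [h]

theorem smul_det_vMatrix_sq {G S : Type*} [CommRing S] [Monoid G] [MulSemiringAction G S] {n : ℕ}
    {a : Fin n → S} {g : G} {σ : Equiv.Perm (Fin n)} (h : ∀ i, g • a i = a (σ i)) :
    g • (vMatrix a).det ^ 2 = (vMatrix a).det ^ 2 := by
  rw [smul_pow', ← MulSemiringAction.toRingHom_apply, map_det_vMatrix]
  simp only [MulSemiringAction.toRingHom_apply, h, det_vMatrix_comp_perm_sq]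

theorem exists_sum_mul_prod_pow_eq_ite {S : Type*} [CommRing S] {n : ℕ} {a : Fin n → S}
    (h : IsUnit (vMatrix a).det) : ∃ x : MultiIndex n → S, ∀ σ : Equiv.Perm (Fin n),
      ∑ J, x J * ∏ k, a (σ k) ^ (J k : ℕ) = if σ = 1 then 1 else 0 := by
  obtain ⟨I₀, hI₀⟩ := permOf_bijective.2 (1 : Equiv.Perm (Fin n))
  refine ⟨fun J => (vMatrix a)⁻¹ J I₀, fun σ => ?_⟩
  obtain ⟨I, rfl⟩ := permOf_bijective.2 σ
  have hentry := congrFun₂ (Matrix.mul_nonsing_inv (vMatrix a) h) I I₀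
  rw [Matrix.mul_apply, Matrix.one_apply] at hentry
  simp only [← hI₀, permOf_injective.eq_iff, ← hentry, vMatrix, Matrix.of_apply, mul_comm]

end Determinants

section GaloisExtensions

theorem exists_forall_apply_smul_eq {A B K G : Type*} [CommRing A] [CommRing B] [CommRing K]
    [IsDomain K] [Algebra A B] [Group G] [Finite G] [MulSemiringAction G B] [SMulCommClass G A B]
    [Algebra.IsInvariant A B G] {χ ψ : B →+* K}
    (h : χ.comp (algebraMap A B) = ψ.comp (algebraMap A B))
    (hsurj : Function.Surjective (χ.comp (algebraMap A B))) :
    ∃ g : G, ∀ b, χ (g • b) = ψ b := by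
  have hunder : (RingHom.ker χ).under A = (RingHom.ker ψ).under A := by
    rw [Ideal.under_def, Ideal.under_def, RingHom.comap_ker, RingHom.comap_ker, h]
  have := RingHom.ker_isPrime χ
  have := RingHom.ker_isPrime ψ
  obtain ⟨g, hg⟩ := Algebra.IsInvariant.exists_smul_of_under_eq A B G _ _ hunder
  refine ⟨g⁻¹, fun b => ?_⟩
  obtain ⟨c, hc⟩ := hsurj (ψ b)
  have hmem : b - algebraMap A B c ∈ RingHom.ker ψ := by
    rw [RingHom.mem_ker, map_sub, ← RingHom.comp_apply, ← h, hc, sub_self]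
  rw [hg, Ideal.mem_pointwise_smul_iff_inv_smul_mem, RingHom.mem_ker, smul_sub, map_sub,
    sub_eq_zero, smul_algebraMap] at hmem
  exact hmem.trans hc

theorem isCHRGalois_of_toAlgAut_surjective {R S : Type*} [CommRing R] [CommRing S] [Algebra R S]
    {n : ℕ} (G : Subgroup (Equiv.Perm (Fin n))) [MulSemiringAction G S] [SMulCommClass G R S]
    [Algebra.IsInvariant R S G] (hinj : Function.Injective (algebraMap R S))
    (hsurj : Function.Surjective (MulSemiringAction.toAlgAut G R S)) {a : Fin n → S}
    (ha : ∀ (g : G) i, g • a i = a (g.1 i)) (hdet : IsUnit (vMatrix a).det) :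
    IsCHRGalois R S ⊤ where
  injective := hinj
  finite := (Finite.of_surjective _ hsurj : Finite (S ≃ₐ[R] S)).of_injective _
    Subtype.val_injective
  fixed s := by
    refine ⟨fun hs => ?_, ?_⟩
    · exact Algebra.IsInvariant.isInvariant (G := G) s fun g =>
        hs (MulSemiringAction.toAlgAut G R S g) (Subgroup.mem_top _)
    · rintro ⟨r, rfl⟩ φ -
      exact φ.commutes r
  dual := by
    obtain ⟨x, hx⟩ := exists_sum_mul_prod_pow_eq_ite hdet
    let e := (Fintype.equivFin (MultiIndex n)).symm
    let y (J : MultiIndex n) : S := ∏ k, a k ^ (J k : ℕ)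
    have smul_y (g : G) (J : MultiIndex n) : g • y J = ∏ k, a (g.1 k) ^ (J k : ℕ) := by
      simp only [y, Finset.smul_prod', smul_pow', ha]
    have sum_smul (g : G) : ∑ j, x (e j) * g • y (e j) = if g = 1 then 1 else 0 := by
      rw [e.sum_comp fun J => x J * g • y J]
      simp only [smul_y, hx, OneMemClass.coe_eq_one]
    refine ⟨_, x ∘ e, y ∘ e, by simpa using sum_smul 1, fun φ _ hφ => ?_⟩
    obtain ⟨g, rfl⟩ := hsurj φ
    have hg : g ≠ 1 := fun hg => hφ (by rw [hg, map_one])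
    exact (sum_smul g).trans (if_neg hg)

end GaloisExtensions

section ContinuousRoots

variable {X Y : Type*} [TopologicalSpace X] [TopologicalSpace Y]

theorem fiberPoly_pullbackPoly (p : C(Y, X)) (f : C(X, ℂ)[X]) (y : Y) :
    fiberPoly (pullbackPoly p f) y = fiberPoly f (p y) := by
  rw [fiberPoly, fiberPoly, pullbackPoly, Polynomial.map_map]
  rfl

theorem pullbackPoly_pullbackPoly {Z : Type*} [TopologicalSpace Z] (p : C(Y, X)) (π : C(Z, Y))
    (f : C(X, ℂ)[X]) : pullbackPoly π (pullbackPoly p f) = pullbackPoly (p.comp π) f := by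
  rw [pullbackPoly, pullbackPoly, Polynomial.map_map]
  rfl

theorem eval_fiberPoly (f : C(X, ℂ)[X]) (a : C(X, ℂ)) (x : X) :
    (fiberPoly f x).eval (a x) = f.eval a x :=
  Polynomial.eval_map_apply (ContinuousMap.evalAlgHom ℂ ℂ x).toRingHom a

theorem isContRoot_iff {f : C(X, ℂ)[X]} {a : C(X, ℂ)} : IsContRoot f a ↔ f.eval a = 0 := by
  simp only [IsContRoot, eval_fiberPoly, ContinuousMap.ext_iff, ContinuousMap.zero_apply]

theorem IsContRoot.comp {f : C(X, ℂ)[X]} {a : C(X, ℂ)} (ha : IsContRoot f a) (p : C(Y, X)) :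
    IsContRoot (pullbackPoly p f) (a.comp p) := fun y => by
  rw [fiberPoly_pullbackPoly]
  exact ha (p y)

variable {n : ℕ} {f : C(X, ℂ)[X]}

theorem IsWeierstrass.pullbackPoly [Nonempty Y] (hf : IsWeierstrass f n) (p : C(Y, X)) :
    IsWeierstrass (pullbackPoly p f) n where
  monic := hf.monic.map _
  natDegree_eq := (hf.monic.natDegree_map _).trans hf.natDegree_eq
  ncard_roots y := by simpa only [fiberPoly_pullbackPoly] using hf.ncard_roots (p y)

theorem IsWeierstrass.fiberPoly_ne_zero (hf : IsWeierstrass f n) (x : X) : fiberPoly f x ≠ 0 :=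
  (hf.monic.map _).ne_zero

theorem IsWeierstrass.finite_roots (hf : IsWeierstrass f n) (x : X) :
    {z : ℂ | (fiberPoly f x).eval z = 0}.Finite :=
  finite_setOfPred_isRoot (hf.fiberPoly_ne_zero x)

theorem IsWeierstrass.separable_fiberPoly (hf : IsWeierstrass f n) (x : X) :
    (fiberPoly f x).Separable := by
  have : Nonempty X := ⟨x⟩
  have hrootSet : (fiberPoly f x).rootSet ℂ = {z | (fiberPoly f x).eval z = 0} := by
    ext z
    simp [mem_rootSet, hf.fiberPoly_ne_zero x]
  rw [← card_rootSet_eq_natDegree_iff_of_splits (K := ℂ) (hf.fiberPoly_ne_zero x)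
    (IsAlgClosed.splits _), ← Nat.card_eq_fintype_card, hrootSet]
  exact (hf.ncard_roots x).trans
    (hf.natDegree_eq.symm.trans (hf.monic.natDegree_map _).symm)

theorem IsWeierstrass.eval_derivative_ne_zero (hf : IsWeierstrass f n) {a : C(X, ℂ)}
    (ha : IsContRoot f a) (x : X) : f.derivative.eval a x ≠ 0 := by
  rw [← eval_fiberPoly, fiberPoly, ← derivative_map]
  exact (hf.separable_fiberPoly x).eval₂_derivative_ne_zero (RingHom.id ℂ) (ha x)

theorem IsWeierstrass.root_eq_of_apply_eq [PreconnectedSpace X] (hf : IsWeierstrass f n)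
    {a b : C(X, ℂ)} (ha : IsContRoot f a) (hb : IsContRoot f b) {x₀ : X} (h : a x₀ = b x₀) :
    a = b := by
  obtain ⟨k, hk⟩ := f.binomExpansion b (a - b)
  have hmul : (a - b) * (f.derivative.eval b + k * (a - b)) = 0 := by
    rw [add_sub_cancel, isContRoot_iff.mp ha, isContRoot_iff.mp hb] at hk
    linear_combination -hk
  have eq_iff_cofactor_ne_zero :
      {x | a x = b x} = {x | (f.derivative.eval b + k * (a - b)) x ≠ 0} := by
    ext x
    have hx := ContinuousMap.congr_fun hmul x
    simp only [ContinuousMap.mul_apply, ContinuousMap.sub_apply, ContinuousMap.zero_apply,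
      mul_eq_zero, sub_eq_zero] at hx
    refine ⟨fun h : a x = b x => ?_, fun h => hx.resolve_right h⟩
    simpa [h] using hf.eval_derivative_ne_zero hb x
  have hclopen : IsClopen {x | a x = b x} := by
    refine ⟨isClosed_eq a.continuous b.continuous, ?_⟩
    rw [eq_iff_cofactor_ne_zero]
    exact isOpen_ne_fun (map_continuous _) continuous_const
  ext x
  exact (hclopen.eq_univ ⟨x₀, h⟩).ge (Set.mem_univ x)

theorem SplitsWithRoots.comp_of_surjective {α : Fin n → C(X, ℂ)} (hα : SplitsWithRoots f α)
    {p : C(Y, X)} (hp : Function.Surjective p) :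
    SplitsWithRoots (SemiTopGalois.pullbackPoly p f) fun i => (α i).comp p :=
  ⟨fun _ _ h => hα.1 ((ContinuousMap.cancel_right hp).mp h), fun i => (hα.2 i).comp p⟩

namespace SplitsWithRoots

variable {α : Fin n → C(X, ℂ)}

theorem apply_injective [PreconnectedSpace X] (hα : SplitsWithRoots f α)
    (hf : IsWeierstrass f n) (x : X) : Function.Injective fun i => α i x :=
  fun i j h => hα.1 (hf.root_eq_of_apply_eq (hα.2 i) (hα.2 j) h)

theorem exists_apply_eq [PreconnectedSpace X] (hα : SplitsWithRoots f α)
    (hf : IsWeierstrass f n) {x : X} {z : ℂ} (hz : (fiberPoly f x).eval z = 0) :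
    ∃ i, α i x = z := by
  have hsub : Set.range (fun i => α i x) ⊆ {z : ℂ | (fiberPoly f x).eval z = 0} := by
    rintro _ ⟨i, rfl⟩
    exact hα.2 i x
  refine (Set.eq_of_subset_of_ncard_le hsub ?_ (hf.finite_roots x)).ge hz
  rw [hf.ncard_roots, ← Nat.card_coe_set_eq,
    Nat.card_range_of_injective (hα.apply_injective hf x), Nat.card_fin]

theorem exists_eq [ConnectedSpace X] (hα : SplitsWithRoots f α)
    (hf : IsWeierstrass f n) {a : C(X, ℂ)} (ha : IsContRoot f a) : ∃ i, α i = a := by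
  obtain ⟨x⟩ := (inferInstance : Nonempty X)
  obtain ⟨i, hi⟩ := hα.exists_apply_eq hf (ha x)
  exact ⟨i, hf.root_eq_of_apply_eq (hα.2 i) ha hi⟩

theorem exists_perm [ConnectedSpace X] (hα : SplitsWithRoots f α)
    (hf : IsWeierstrass f n) {a : Fin n → C(X, ℂ)} (ha : SplitsWithRoots f a) :
    ∃ τ : Equiv.Perm (Fin n), ∀ i, a i = α (τ i) := by
  choose t ht using fun i => hα.exists_eq hf (ha.2 i)
  have ht_inj : Function.Injective t := fun i j h => ha.1 (by rw [← ht, ← ht, h])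
  exact ⟨Equiv.ofBijective t (Finite.injective_iff_bijective.mp ht_inj), fun i => (ht i).symm⟩

end SplitsWithRoots

end ContinuousRoots

section Coverings

variable {X Y : Type*} [TopologicalSpace X] [TopologicalSpace Y] [Nonempty Y]
  [PathConnectedSpace X] {p : C(Y, X)}

theorem surjective_of_isCoveringMap (hp : IsCoveringMap p) : Function.Surjective p := by
  intro x
  obtain ⟨y⟩ := (inferInstance : Nonempty Y)
  obtain ⟨γ⟩ := PathConnectedSpace.joined (p y) x
  exact ⟨hp.liftPath γ.toContinuousMap y γ.source 1,
    (congrFun (hp.liftPath_lifts γ.toContinuousMap y γ.source) 1).trans γ.target⟩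

theorem isQuotientMap_of_isCoveringMap (hp : IsCoveringMap p) : Topology.IsQuotientMap p :=
  hp.isQuotientMap (surjective_of_isCoveringMap hp)

theorem exists_pullback_eq (hp : IsCoveringMap p) (g : C(Y, ℂ))
    (hg : ∀ y y', p y = p y' → g y = g y') : ∃ γ : C(X, ℂ), pullback p γ = g :=
  have hq := isQuotientMap_of_isCoveringMap hp
  ⟨hq.lift g hg, hq.lift_comp g hg⟩

end Coverings

section Monodromy

variable {X Y : Type*} [TopologicalSpace X] [TopologicalSpace Y] {n : ℕ}

/-- The points `y` and `y'` lie in the same fibre of `p`, and the permutation `σ` describes how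
the values of `α_1, …, α_n` at `y'` arise from those at `y`. -/
def MonodromyRel (p : C(Y, X)) (α : Fin n → C(Y, ℂ)) (σ : Equiv.Perm (Fin n)) (y y' : Y) : Prop :=
  p y' = p y ∧ ∀ i, α i y' = α (σ i) y

theorem MonodromyRel.refl (p : C(Y, X)) (α : Fin n → C(Y, ℂ)) (y : Y) :
    MonodromyRel p α 1 y y :=
  ⟨rfl, fun _ => rfl⟩

theorem MonodromyRel.trans {p : C(Y, X)} {α : Fin n → C(Y, ℂ)} {σ τ : Equiv.Perm (Fin n)}
    {y y' y'' : Y} (hσ : MonodromyRel p α σ y y') (hτ : MonodromyRel p α τ y' y'') :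
    MonodromyRel p α (σ * τ) y y'' :=
  ⟨hτ.1.trans hσ.1, fun i => (hτ.2 i).trans (hσ.2 (τ i))⟩

/-- The monodromy group of the functions `α_1, …, α_n` on `Y` over `X`: the permutations that
describe, from every point of `Y`, the passage to some other point of its fibre. For the roots of
a Weierstrass polynomial on a path-connected covering this is the monodromy of paths in `X`. -/
def monodromyGroup (p : C(Y, X)) (α : Fin n → C(Y, ℂ)) : Subgroup (Equiv.Perm (Fin n)) :=
  let M : Submonoid (Equiv.Perm (Fin n)) :=
    { carrier := {σ | ∀ y, ∃ y', MonodromyRel p α σ y y'}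
      one_mem' := fun y => ⟨y, .refl p α y⟩
      mul_mem' := fun hσ hτ y =>
        have ⟨y', hy'⟩ := hσ y
        have ⟨y'', hy''⟩ := hτ y'
        ⟨y'', hy'.trans hy''⟩ }
  { M with
    inv_mem' := fun {σ} hσ => Submonoid.powers_le.mpr hσ <|
      (isOfFinOrder_of_finite σ).mem_powers_iff_mem_zpowers.mpr <|
        inv_mem (Subgroup.mem_zpowers σ) }

variable [PathConnectedSpace Y] {p : C(Y, X)} {f : C(X, ℂ)[X]} {α : Fin n → C(Y, ℂ)}

theorem MonodromyRel.mem_monodromyGroup (hf : IsWeierstrass f n) (hp : IsCoveringMap p)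
    (hα : ∀ i, IsContRoot (pullbackPoly p f) (α i)) {σ : Equiv.Perm (Fin n)} {y y' : Y}
    (h : MonodromyRel p α σ y y') : σ ∈ monodromyGroup p α := by
  intro y₁
  obtain ⟨γ⟩ := PathConnectedSpace.joined y y₁
  have hstart : p.comp γ.toContinuousMap 0 = p y' := (congrArg p γ.source).trans h.1.symm
  let Γ := hp.liftPath (p.comp γ.toContinuousMap) y' hstart
  have hΓ : p.comp Γ = p.comp γ.toContinuousMap :=
    ContinuousMap.ext (congrFun (hp.liftPath_lifts _ y' hstart))
  have root_comp_eq (i : Fin n) : (α i).comp Γ = (α (σ i)).comp γ.toContinuousMap := by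
    refine (hf.pullbackPoly (p.comp γ.toContinuousMap)).root_eq_of_apply_eq (x₀ := 0) ?_ ?_ ?_
    · rw [← hΓ, ← pullbackPoly_pullbackPoly]
      exact (hα i).comp Γ
    · rw [← pullbackPoly_pullbackPoly]
      exact (hα (σ i)).comp γ.toContinuousMap
    · exact (congrArg (α i) (hp.liftPath_zero _ y' hstart)).trans
        ((h.2 i).trans (congrArg (α (σ i)) γ.source.symm))
  exact ⟨Γ 1, (ContinuousMap.congr_fun hΓ 1).trans (congrArg p γ.target), fun i =>
    (ContinuousMap.congr_fun (root_comp_eq i) 1).trans (congrArg (α (σ i)) γ.target)⟩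

theorem SplitsWithRoots.exists_monodromyRel (hf : IsWeierstrass f n)
    (hα : SplitsWithRoots (pullbackPoly p f) α) {y y' : Y} (hy : p y' = p y) :
    ∃ σ, MonodromyRel p α σ y y' := by
  have hw := hf.pullbackPoly p
  have hex (i : Fin n) : ∃ j, α j y = α i y' := by
    refine hα.exists_apply_eq hw ?_
    rw [fiberPoly_pullbackPoly, ← hy, ← fiberPoly_pullbackPoly]
    exact hα.2 i y'
  choose s hs using hex
  have hs_inj : Function.Injective s := fun i j h =>
    hα.apply_injective hw y' (by simp only [← hs, h])
  exact ⟨Equiv.ofBijective s (Finite.injective_iff_bijective.mp hs_inj), hy, fun i => (hs i).symm⟩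

theorem SplitsWithRoots.exists_mem_monodromyGroup (hf : IsWeierstrass f n) (hp : IsCoveringMap p)
    (hα : SplitsWithRoots (pullbackPoly p f) α) {y y' : Y} (hy : p y' = p y) :
    ∃ σ ∈ monodromyGroup p α, MonodromyRel p α σ y y' :=
  have ⟨σ, hσ⟩ := hα.exists_monodromyRel hf hy
  ⟨σ, hσ.mem_monodromyGroup hf hp hα.2, hσ⟩

end Monodromy

section RootRing

variable {X Y : Type*} [TopologicalSpace X] [TopologicalSpace Y] {n : ℕ}

/-- The root `α_i` as an element of `R[α_1, …, α_n]`. -/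
noncomputable def rootRingGen (p : C(Y, X)) (α : Fin n → C(Y, ℂ)) (i : Fin n) : rootRing p α :=
  ⟨α i, Algebra.subset_adjoin ⟨i, rfl⟩⟩

/-- Evaluation at a point, on `R[α_1, …, α_n]`. -/
noncomputable def rootRingEval (p : C(Y, X)) (α : Fin n → C(Y, ℂ)) (y : Y) : rootRing p α →+* ℂ :=
  (ContinuousMap.evalAlgHom ℂ ℂ y).toRingHom.comp (rootRing p α).val.toRingHom

/-- The pullback `γ ↦ γ ∘ p`, with values in `R = p^* C(X)`. -/
noncomputable def toPullbackRing (p : C(Y, X)) : C(X, ℂ) →+* pullbackRing p :=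
  (pullback p).rangeRestrict

variable {p : C(Y, X)} {α : Fin n → C(Y, ℂ)}

theorem rootRing_ext {s t : rootRing p α} (h : ∀ y, (s : C(Y, ℂ)) y = (t : C(Y, ℂ)) y) : s = t :=
  Subtype.ext (ContinuousMap.ext h)

theorem galoisGroup_ext {φ ψ : GaloisGroup p α}
    (h : ∀ i, φ (rootRingGen p α i) = ψ (rootRingGen p α i)) : φ = ψ := by
  have hφψ : φ.toAlgHom = ψ.toAlgHom := by
    refine AlgHom.adjoin_ext ?_
    rintro _ ⟨i, rfl⟩
    exact h i
  exact AlgEquiv.ext fun s => DFunLike.congr_fun hφψ s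

theorem pullbackRing_apply_eq (r : pullbackRing p) {y y' : Y} (h : p y' = p y) :
    (r : C(Y, ℂ)) y' = (r : C(Y, ℂ)) y := by
  obtain ⟨_, γ, rfl⟩ := r
  exact congrArg γ h

theorem MonodromyRel.apply_aeval_eq {σ : Equiv.Perm (Fin n)} {y y' : Y}
    (h : MonodromyRel p α σ y y') (P : MvPolynomial (Fin n) (pullbackRing p)) :
    MvPolynomial.aeval α P y' = MvPolynomial.aeval α (MvPolynomial.rename σ P) y := by
  let ev (z : Y) : C(Y, ℂ) →+* ℂ := (ContinuousMap.evalAlgHom ℂ ℂ z).toRingHom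
  have hev : (ev y').comp (MvPolynomial.aeval α).toRingHom =
      (ev y).comp ((MvPolynomial.aeval α).comp
        (MvPolynomial.rename (R := pullbackRing p) σ)).toRingHom := by
    refine MvPolynomial.ringHom_ext (fun r => ?_) fun i => ?_
    · simp only [RingHom.comp_apply, AlgHom.toRingHom_eq_coe, RingHom.coe_coe, AlgHom.comp_apply,
        MvPolynomial.rename_C, MvPolynomial.aeval_C]
      exact pullbackRing_apply_eq r h.1
    · simpa [ev] using h.2 i
  exact RingHom.congr_fun hev P

theorem exists_forall_monodromyRel_apply_eq (σ : Equiv.Perm (Fin n)) (s : rootRing p α) :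
    ∃ t : rootRing p α, ∀ y y', MonodromyRel p α σ y y' →
      (t : C(Y, ℂ)) y = (s : C(Y, ℂ)) y' := by
  have hrange := Algebra.adjoin_range_eq_range_aeval (pullbackRing p) α
  obtain ⟨P, hP⟩ := hrange.le s.2
  refine ⟨⟨MvPolynomial.aeval α (MvPolynomial.rename σ P), hrange.ge ⟨_, rfl⟩⟩, fun y y' h => ?_⟩
  rw [← hP]
  exact (h.apply_aeval_eq P).symm

noncomputable instance : SMul (monodromyGroup p α) (rootRing p α) where
  smul σ s := (exists_forall_monodromyRel_apply_eq σ.1 s).choose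

theorem MonodromyRel.smul_apply {σ : monodromyGroup p α} {y y' : Y}
    (h : MonodromyRel p α σ y y') (s : rootRing p α) :
    ((σ • s : rootRing p α) : C(Y, ℂ)) y = (s : C(Y, ℂ)) y' :=
  (exists_forall_monodromyRel_apply_eq σ.1 s).choose_spec y y' h

noncomputable instance : MulSemiringAction (monodromyGroup p α) (rootRing p α) where
  one_smul s := rootRing_ext fun y => (MonodromyRel.refl p α y).smul_apply (σ := 1) s
  mul_smul σ τ s := rootRing_ext fun y => by
    obtain ⟨y', hσ⟩ := σ.2 y
    obtain ⟨y'', hτ⟩ := τ.2 y'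
    rw [(hσ.trans hτ).smul_apply (σ := σ * τ), hσ.smul_apply, hτ.smul_apply]
  smul_zero σ := rootRing_ext fun y => have ⟨_, h⟩ := σ.2 y; h.smul_apply 0
  smul_one σ := rootRing_ext fun y => have ⟨_, h⟩ := σ.2 y; h.smul_apply 1
  smul_add σ s t := rootRing_ext fun y => by
    obtain ⟨y', h⟩ := σ.2 y
    exact (h.smul_apply _).trans (congrArg₂ (· + ·) (h.smul_apply s) (h.smul_apply t)).symm
  smul_mul σ s t := rootRing_ext fun y => by
    obtain ⟨y', h⟩ := σ.2 y
    exact (h.smul_apply _).trans (congrArg₂ (· * ·) (h.smul_apply s) (h.smul_apply t)).symm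

instance : SMulCommClass (monodromyGroup p α) (pullbackRing p) (rootRing p α) where
  smul_comm σ r s := rootRing_ext fun y => by
    obtain ⟨y', h⟩ := σ.2 y
    exact (h.smul_apply _).trans
      (congrArg₂ (· * ·) (pullbackRing_apply_eq r h.1) (h.smul_apply s).symm)

theorem smul_rootRingGen (σ : monodromyGroup p α) (i : Fin n) :
    σ • rootRingGen p α i = rootRingGen p α (σ.1 i) := rootRing_ext fun y => by
  obtain ⟨y', h⟩ := σ.2 y
  exact (h.smul_apply _).trans (h.2 i)

theorem rootRingEval_det_vMatrix (y : Y) :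
    rootRingEval p α y (vMatrix (rootRingGen p α)).det = Delta α y :=
  map_det_vMatrix (rootRingEval p α y) (rootRingGen p α)

variable {f : C(X, ℂ)[X]}

theorem isContRoot_coe_iff {s : rootRing p α} : IsContRoot (pullbackPoly p f) (s : C(Y, ℂ)) ↔
    aeval s (f.map (toPullbackRing p)) = 0 := by
  have h := aeval_algHom_apply (rootRing p α).val s (f.map (toPullbackRing p))
  rw [aeval_def, eval₂_map] at h
  rw [isContRoot_iff, pullbackPoly, eval_map, ← Subtype.coe_inj]
  exact Eq.congr_left h

theorem IsContRoot.galoisGroup_apply {s : rootRing p α}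
    (hs : IsContRoot (pullbackPoly p f) (s : C(Y, ℂ))) (φ : GaloisGroup p α) :
    IsContRoot (pullbackPoly p f) (φ s : C(Y, ℂ)) := by
  rw [isContRoot_coe_iff] at hs ⊢
  exact (aeval_algHom_apply φ.toAlgHom s _).trans ((congrArg φ hs).trans (map_zero φ))

end RootRing

section GaloisGroup

variable {X Y : Type*} [TopologicalSpace X] [TopologicalSpace Y] [PathConnectedSpace X]
  [PathConnectedSpace Y] {n : ℕ} {p : C(Y, X)} {f : C(X, ℂ)[X]} {α : Fin n → C(Y, ℂ)}

theorem isInvariant_rootRing (hf : IsWeierstrass f n) (hp : IsCoveringMap p)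
    (hα : SplitsWithRoots (pullbackPoly p f) α) :
    Algebra.IsInvariant (pullbackRing p) (rootRing p α) (monodromyGroup p α) where
  isInvariant s hs := by
    obtain ⟨γ, hγ⟩ := exists_pullback_eq hp s fun y y' hy => by
      obtain ⟨σ, hσ, hrel⟩ := hα.exists_mem_monodromyGroup hf hp hy.symm
      rw [← hrel.smul_apply (σ := ⟨σ, hσ⟩), hs]
    exact ⟨⟨s, γ, hγ⟩, rfl⟩

theorem isUnit_det_vMatrix (hf : IsWeierstrass f n) (hp : IsCoveringMap p)
    (hα : SplitsWithRoots (pullbackPoly p f) α) : IsUnit (vMatrix (rootRingGen p α)).det := by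
  obtain ⟨⟨_, D, rfl⟩, hD⟩ := (isInvariant_rootRing hf hp hα).isInvariant
    ((vMatrix (rootRingGen p α)).det ^ 2) fun σ => smul_det_vMatrix_sq (smul_rootRingGen σ)
  have D_comp (y : Y) : D (p y) = Delta α y ^ 2 := by
    rw [← rootRingEval_det_vMatrix (p := p), ← map_pow, ← hD]
    rfl
  have hunit : IsUnit D := by
    rw [ContinuousMap.isUnit_iff_forall_ne_zero]
    intro x
    obtain ⟨y, rfl⟩ := surjective_of_isCoveringMap hp x
    rw [D_comp]
    exact pow_ne_zero 2 (det_vMatrix_ne_zero (hα.apply_injective (hf.pullbackPoly p) y))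
  rw [← isUnit_pow_iff two_ne_zero, ← hD]
  exact (hunit.map (toPullbackRing p)).map (algebraMap _ _)

theorem exists_mem_rootRing_Delta_mul_eq_one (hf : IsWeierstrass f n) (hp : IsCoveringMap p)
    (hα : SplitsWithRoots (pullbackPoly p f) α) :
    ∃ g ∈ rootRing p α, ∀ y, Delta α y * g y = 1 := by
  obtain ⟨g, hg⟩ := (isUnit_det_vMatrix hf hp hα).exists_right_inv
  refine ⟨g, g.2, fun y => ?_⟩
  have heval := congrArg (rootRingEval p α y) hg
  rwa [map_mul, map_one, rootRingEval_det_vMatrix] at heval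

theorem toAlgAut_surjective (hf : IsWeierstrass f n) (hp : IsCoveringMap p)
    (hα : SplitsWithRoots (pullbackPoly p f) α) :
    Function.Surjective (MulSemiringAction.toAlgAut (monodromyGroup p α) (pullbackRing p)
      (rootRing p α)) := by
  intro φ
  obtain ⟨y⟩ := (inferInstance : Nonempty Y)
  have := isInvariant_rootRing hf hp hα
  obtain ⟨σ, hσ⟩ := exists_forall_apply_smul_eq (A := pullbackRing p) (B := rootRing p α)
    (G := monodromyGroup p α) (χ := rootRingEval p α y)
    (ψ := (rootRingEval p α y).comp (φ : rootRing p α →+* rootRing p α))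
    (RingHom.ext fun r => congrArg (rootRingEval p α y) (φ.commutes r).symm)
    fun c => ⟨toPullbackRing p (.const X c), rfl⟩
  refine ⟨σ, galoisGroup_ext fun i => Subtype.ext ?_⟩
  have hroot : IsContRoot (pullbackPoly p f) (rootRingGen p α i : C(Y, ℂ)) := hα.2 i
  exact (hf.pullbackPoly p).root_eq_of_apply_eq (hroot.galoisGroup_apply _)
    (hroot.galoisGroup_apply φ) (hσ (rootRingGen p α i))

theorem isCHRGalois_rootRing (hf : IsWeierstrass f n) (hp : IsCoveringMap p)
    (hα : SplitsWithRoots (pullbackPoly p f) α) :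
    IsCHRGalois (pullbackRing p) (rootRing p α) ⊤ :=
  have := isInvariant_rootRing hf hp hα
  isCHRGalois_of_toAlgAut_surjective (monodromyGroup p α)
    (fun _ _ h => Subtype.ext (congrArg (Subtype.val : rootRing p α → C(Y, ℂ)) h))
    (toAlgAut_surjective hf hp hα) smul_rootRingGen (isUnit_det_vMatrix hf hp hα)

end GaloisGroup

section FreeActions

theorem exists_nhds_smul_image_inter_nonempty {G E F : Type*} [Group G] [Finite G]
    [TopologicalSpace E] [MulAction G E] [ContinuousConstSMul G E] [TopologicalSpace F] [T2Space F]
    {c : E → F} (hc : Continuous c) {e : E} (he : ∀ g : G, c (g • e) = c e → g = 1) :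
    ∃ U ∈ nhds e, ∀ g : G, ((g • ·) '' U ∩ U).Nonempty → g = 1 := by
  have separate (g : G) :
      ∃ U ∈ nhds e, g ≠ 1 → ∀ z ∈ U, ∀ w ∈ U, c (g • z) ≠ c w := by
    by_cases hg : g = 1
    · exact ⟨Set.univ, Filter.univ_mem, fun h => (h hg).elim⟩
    obtain ⟨V, W, hV, hW, hVe, hWe, hVW⟩ := t2_separation fun h => hg (he g h)
    have hcg : Continuous fun z => c (g • z) := hc.comp (continuous_const_smul g)
    exact ⟨_, Filter.inter_mem (hcg.continuousAt (hV.mem_nhds hVe))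
      (hc.continuousAt (hW.mem_nhds hWe)), fun _ z hz w hw => hVW.ne_of_mem hz.1 hw.2⟩
  choose U hU hne using separate
  refine ⟨⋂ g, U g, Filter.iInter_mem.mpr hU, fun g => ?_⟩
  rintro ⟨_, ⟨z, hz, rfl⟩, hgz⟩
  by_contra hg
  exact hne g hg z (Set.mem_iInter.mp hz g) _ (Set.mem_iInter.mp hgz g) rfl

end FreeActions

section RootImage

variable {X Y : Type*} [TopologicalSpace X] [TopologicalSpace Y] {n : ℕ}

/-- The map `y ↦ (p y, (α_1 y, …, α_n y))`. -/
noncomputable def rootMap (p : C(Y, X)) (α : Fin n → C(Y, ℂ)) : C(Y, X × (Fin n → ℂ)) :=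
  p.prodMk (ContinuousMap.pi α)

/-- The image of `Y` in `X × ℂⁿ`, the smallest quotient of `Y` over `X` on which the functions
`α_1, …, α_n` are defined. For the roots of a Weierstrass polynomial it is the model of a splitting
covering. -/
abbrev RootImage (p : C(Y, X)) (α : Fin n → C(Y, ℂ)) : Type _ :=
  Set.range (rootMap p α)

/-- The projection of `RootImage p α` to `X`. -/
def rootImageProj (p : C(Y, X)) (α : Fin n → C(Y, ℂ)) : C(RootImage p α, X) :=
  ⟨fun z => z.1.1, by fun_prop⟩

/-- The function on `RootImage p α` induced by `α_i`. -/
def rootImageCoord (p : C(Y, X)) (α : Fin n → C(Y, ℂ)) (i : Fin n) : C(RootImage p α, ℂ) :=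
  ⟨fun z => z.1.2 i, by fun_prop⟩

/-- The quotient map from `Y` to `RootImage p α`. -/
noncomputable def toRootImage (p : C(Y, X)) (α : Fin n → C(Y, ℂ)) : C(Y, RootImage p α) :=
  ⟨fun y => ⟨rootMap p α y, y, rfl⟩, by fun_prop⟩

variable {p : C(Y, X)} {α : Fin n → C(Y, ℂ)} {f : C(X, ℂ)[X]}

theorem rootImage_ext {z z' : RootImage p α} (h : rootImageProj p α z = rootImageProj p α z')
    (h' : ∀ i, rootImageCoord p α i z = rootImageCoord p α i z') : z = z' :=
  Subtype.ext (Prod.ext h (funext h'))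

theorem toRootImage_surjective : Function.Surjective (toRootImage p α) := by
  rintro ⟨_, y, rfl⟩
  exact ⟨y, rfl⟩

instance [PathConnectedSpace Y] : PathConnectedSpace (RootImage p α) :=
  isPathConnected_iff_pathConnectedSpace.mp (isPathConnected_range (rootMap p α).continuous)

theorem splitsWithRoots_rootImageCoord (hα : SplitsWithRoots (pullbackPoly p f) α) :
    SplitsWithRoots (pullbackPoly (rootImageProj p α) f) (rootImageCoord p α) := by
  refine ⟨fun i j h => hα.1 (ContinuousMap.ext fun y => ?_), fun i => ?_⟩
  · exact ContinuousMap.congr_fun h (toRootImage p α y)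
  · rintro ⟨_, y, rfl⟩
    have hroot := hα.2 i y
    rw [fiberPoly_pullbackPoly] at hroot ⊢
    exact hroot

instance : MulAction (monodromyGroup p α) (RootImage p α) where
  smul σ z := ⟨(z.1.1, fun i => z.1.2 (σ.1⁻¹ i)), by
    obtain ⟨_, y, rfl⟩ := z
    obtain ⟨y', hy⟩ := (σ⁻¹).2 y
    exact ⟨y', Prod.ext hy.1 (funext hy.2)⟩⟩
  one_smul _ := rfl
  mul_smul σ τ z := rootImage_ext rfl fun i => congrArg (fun ρ : Equiv.Perm (Fin n) => z.1.2 (ρ i))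
    (mul_inv_rev σ.1 τ.1)

theorem rootImageCoord_smul (σ : monodromyGroup p α) (z : RootImage p α) (i : Fin n) :
    rootImageCoord p α i (σ • z) = rootImageCoord p α (σ.1⁻¹ i) z := rfl

instance : ContinuousConstSMul (monodromyGroup p α) (RootImage p α) where
  continuous_const_smul σ := by
    refine Continuous.subtype_mk (Continuous.prodMk ?_ (continuous_pi fun i => ?_)) _
    · exact (rootImageProj p α).continuous
    · exact (rootImageCoord p α (σ.1⁻¹ i)).continuous

theorem MonodromyRel.inv_smul_toRootImage {σ : monodromyGroup p α} {y y' : Y}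
    (h : MonodromyRel p α σ y y') : σ⁻¹ • toRootImage p α y = toRootImage p α y' :=
  rootImage_ext h.1.symm fun i => by
    rw [rootImageCoord_smul, InvMemClass.coe_inv, inv_inv]
    exact (h.2 i).symm

variable [PathConnectedSpace Y]

theorem eq_one_of_forall_rootImageCoord_smul_eq (hf : IsWeierstrass f n)
    (hα : SplitsWithRoots (pullbackPoly p f) α) {σ : monodromyGroup p α} {z : RootImage p α}
    (h : ∀ i, rootImageCoord p α i (σ • z) = rootImageCoord p α i z) : σ = 1 := by
  have hinj := (splitsWithRoots_rootImageCoord hα).apply_injective (hf.pullbackPoly _) z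
  exact inv_eq_one.mp (Subtype.ext (Equiv.ext fun i => hinj (h i)))

theorem isQuotientCoveringMap_rootImageProj [PathConnectedSpace X] (hf : IsWeierstrass f n)
    (hp : IsCoveringMap p) (hα : SplitsWithRoots (pullbackPoly p f) α) :
    IsQuotientCoveringMap (rootImageProj p α) (monodromyGroup p α) where
  __ := Topology.IsQuotientMap.of_comp (toRootImage p α).continuous (rootImageProj p α).continuous
    (isQuotientMap_of_isCoveringMap hp)
  continuous_const_smul := continuous_const_smul
  apply_eq_iff_mem_orbit {z z'} := by
    refine ⟨fun h => ?_, ?_⟩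
    · obtain ⟨y, rfl⟩ := toRootImage_surjective z
      obtain ⟨y', rfl⟩ := toRootImage_surjective z'
      obtain ⟨σ, hσ, hrel⟩ := hα.exists_mem_monodromyGroup hf hp h
      exact ⟨⟨σ, hσ⟩⁻¹, hrel.inv_smul_toRootImage (σ := ⟨σ, hσ⟩)⟩
    · rintro ⟨σ, rfl⟩
      rfl
  disjoint z :=
    exists_nhds_smul_image_inter_nonempty (c := fun z => z.1.2) (by fun_prop) fun _ h =>
      eq_one_of_forall_rootImageCoord_smul_eq hf hα (congrFun h)

end RootImage

section SplittingCoverings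

variable {X E : Type u} [TopologicalSpace X] [TopologicalSpace E] [PathConnectedSpace X] {n : ℕ}
  {f : C(X, ℂ)[X]} {q : C(E, X)} {β : Fin n → C(E, ℂ)}

namespace IsSplittingCovering

theorem toRootImage_bijective (hq : IsSplittingCovering f n q) (hf : IsWeierstrass f n)
    (hβ : SplitsWithRoots (pullbackPoly q f) β) : Function.Bijective (toRootImage q β) := by
  have := hq.pathConnected
  have hsplit := splitsWithRoots_rootImageCoord hβ
  obtain ⟨π, hπ, hqπ⟩ := hq.smallest (RootImage q β) (rootImageProj q β)
    (isQuotientCoveringMap_rootImageProj hf hq.isCoveringMap hβ).isCoveringMap ⟨_, hsplit⟩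
  have hβπ := hβ.comp_of_surjective (surjective_of_isCoveringMap hπ)
  rw [pullbackPoly_pullbackPoly, hqπ] at hβπ
  obtain ⟨τ, hτ⟩ := hβπ.exists_perm (hf.pullbackPoly _) hsplit
  refine ⟨fun e e' h => ?_, toRootImage_surjective⟩
  obtain ⟨z, rfl⟩ := surjective_of_isCoveringMap hπ e
  obtain ⟨z', rfl⟩ := surjective_of_isCoveringMap hπ e'
  refine congrArg π (rootImage_ext ?_ fun i => ?_)
  · rw [← hqπ]
    exact congrArg (rootImageProj q β) h
  · rw [hτ]
    exact congrArg (rootImageCoord q β (τ i)) h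

theorem isHomeomorph_toRootImage (hq : IsSplittingCovering f n q) (hf : IsWeierstrass f n)
    (hβ : SplitsWithRoots (pullbackPoly q f) β) : IsHomeomorph (toRootImage q β) :=
  have := hq.pathConnected
  have hproj := (isQuotientCoveringMap_rootImageProj hf hq.isCoveringMap hβ).isCoveringMap
  have hlocal : IsLocalHomeomorph (toRootImage q β) :=
    .of_comp (g := rootImageProj q β) (hg := hproj.isLocalHomeomorph)
      (hgf := hq.isCoveringMap.isLocalHomeomorph) (toRootImage q β).continuous
  (hlocal.toHomeomorphOfBijective (hq.toRootImage_bijective hf hβ)).isHomeomorph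

theorem exists_coveringTransformation_apply_inv (hq : IsSplittingCovering f n q)
    (hf : IsWeierstrass f n) (hβ : SplitsWithRoots (pullbackPoly q f) β)
    (σ : monodromyGroup q β) :
    ∃ Φ ∈ coveringTransformations q, ∀ e, MonodromyRel q β σ e (Φ⁻¹ e) := by
  let h := (hq.isHomeomorph_toRootImage hf hβ).homeomorph
  let Ψ : E ≃ₜ E := (h.trans (Homeomorph.smul σ⁻¹)).trans h.symm
  have hΨ (e : E) : toRootImage q β (Ψ e) = σ⁻¹ • toRootImage q β e := h.apply_symm_apply _
  have hrel (e : E) : MonodromyRel q β σ e (Ψ e) := by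
    refine ⟨congrArg (rootImageProj q β) (hΨ e), fun i => ?_⟩
    have hi := congrArg (rootImageCoord q β i) (hΨ e)
    rwa [rootImageCoord_smul, InvMemClass.coe_inv, inv_inv] at hi
  exact ⟨Ψ⁻¹, inv_mem fun e => (hrel e).1, by simpa only [inv_inv] using hrel⟩

end IsSplittingCovering

end SplittingCoverings

section CoveringTransformations

variable {X E : Type*} [TopologicalSpace X] [TopologicalSpace E] {n : ℕ} {f : C(X, ℂ)[X]}
  {q : C(E, X)} {β : Fin n → C(E, ℂ)}

theorem exists_monodromyRel_of_coveringTransformation [PathConnectedSpace E]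
    (hf : IsWeierstrass f n) (hβ : SplitsWithRoots (pullbackPoly q f) β)
    (Φ : coveringTransformations q) :
    ∃ σ : monodromyGroup q β, ∀ e, MonodromyRel q β σ e ((Φ : E ≃ₜ E)⁻¹ e) := by
  let Ψ : E ≃ₜ E := (Φ : E ≃ₜ E)⁻¹
  have hΨ (e : E) : q (Ψ e) = q e := (Φ⁻¹).2 e
  have hβΨ := hβ.comp_of_surjective (p := (Ψ : C(E, E))) Ψ.surjective
  rw [pullbackPoly_pullbackPoly, show q.comp (Ψ : C(E, E)) = q from ContinuousMap.ext hΨ] at hβΨ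
  obtain ⟨σ, hσ⟩ := hβ.exists_perm (hf.pullbackPoly q) hβΨ
  have hrel (e : E) : MonodromyRel q β σ e (Ψ e) :=
    ⟨hΨ e, fun i => ContinuousMap.congr_fun (hσ i) e⟩
  exact ⟨⟨σ, fun e => ⟨Ψ e, hrel e⟩⟩, hrel⟩

theorem exists_coveringTransformations_hom [PathConnectedSpace E] (hf : IsWeierstrass f n)
    (hβ : SplitsWithRoots (pullbackPoly q f) β) :
    ∃ ω : coveringTransformations q →* GaloisGroup q β,
      ∀ (Φ : coveringTransformations q) (s : rootRing q β) (e : E),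
        (ω Φ s : C(E, ℂ)) e = (s : C(E, ℂ)) ((Φ : E ≃ₜ E)⁻¹ e) := by
  choose σ hσ using exists_monodromyRel_of_coveringTransformation hf hβ
  let ω (Φ : coveringTransformations q) : GaloisGroup q β :=
    MulSemiringAction.toAlgAut (monodromyGroup q β) (pullbackRing q) (rootRing q β) (σ Φ)
  have ω_apply (Φ : coveringTransformations q) (s : rootRing q β) (e : E) :
      (ω Φ s : C(E, ℂ)) e = (s : C(E, ℂ)) ((Φ : E ≃ₜ E)⁻¹ e) := (hσ Φ e).smul_apply s
  refine ⟨MonoidHom.mk' ω fun Φ Ψ => AlgEquiv.ext fun s => rootRing_ext fun e => ?_, ω_apply⟩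
  rw [ω_apply, AlgEquiv.mul_apply, ω_apply, ω_apply, Subgroup.coe_mul, mul_inv_rev]
  rfl

theorem IsSplittingCovering.coveringTransformations_hom_surjective {X E : Type u}
    [TopologicalSpace X] [TopologicalSpace E] [PathConnectedSpace X] {f : C(X, ℂ)[X]} {q : C(E, X)}
    {β : Fin n → C(E, ℂ)} (hq : IsSplittingCovering f n q) (hf : IsWeierstrass f n)
    (hβ : SplitsWithRoots (pullbackPoly q f) β)
    {ω : coveringTransformations q →* GaloisGroup q β}
    (hω : ∀ (Φ : coveringTransformations q) (s : rootRing q β) (e : E),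
      (ω Φ s : C(E, ℂ)) e = (s : C(E, ℂ)) ((Φ : E ≃ₜ E)⁻¹ e)) : Function.Surjective ω := by
  have := hq.pathConnected
  intro φ
  obtain ⟨σ, rfl⟩ := toAlgAut_surjective hf hq.isCoveringMap hβ φ
  obtain ⟨Φ, hΦ, hrel⟩ := hq.exists_coveringTransformation_apply_inv hf hβ σ
  exact ⟨⟨Φ, hΦ⟩, AlgEquiv.ext fun s => rootRing_ext fun e =>
    (hω _ s e).trans ((hrel e).smul_apply s).symm⟩

end CoveringTransformations

section Conjugation

variable {A B S T : Type*} [CommSemiring A] [CommSemiring B] [Semiring S] [Semiring T] [Algebra A S]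
  [Algebra B T]

/-- Conjugation of algebra automorphisms by a ring isomorphism that carries the scalars of `S` to
those of `T`. The ground rings themselves are not related by a map. -/
def conjAlgEquiv (Θ : S ≃+* T) (h : ∀ s, Θ s ∈ Set.range (algebraMap B T) →
    s ∈ Set.range (algebraMap A S)) (φ : S ≃ₐ[A] S) : T ≃ₐ[B] T :=
  AlgEquiv.ofRingEquiv (f := (Θ.symm.trans φ.toRingEquiv).trans Θ) fun b => by
    obtain ⟨a, ha⟩ := h (Θ.symm (algebraMap B T b)) (by simp)
    change Θ (φ (Θ.symm (algebraMap B T b))) = algebraMap B T b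
    rw [← ha, φ.commutes, ha, Θ.apply_symm_apply]

/-- The group isomorphism given by `conjAlgEquiv`, when the isomorphism `Θ` identifies the scalars
of `S` with those of `T`. -/
def conjMulEquiv (Θ : S ≃+* T) (h : ∀ s, Θ s ∈ Set.range (algebraMap B T) ↔
    s ∈ Set.range (algebraMap A S)) : (S ≃ₐ[A] S) ≃* (T ≃ₐ[B] T) where
  toFun := conjAlgEquiv Θ fun s => (h s).mp
  invFun := conjAlgEquiv Θ.symm fun t ht => by simpa using (h (Θ.symm t)).mpr ht
  left_inv φ := AlgEquiv.ext fun s => by simp [conjAlgEquiv]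
  right_inv φ := AlgEquiv.ext fun s => by simp [conjAlgEquiv]
  map_mul' φ ψ := AlgEquiv.ext fun s => by simp [conjAlgEquiv]

theorem conjMulEquiv_apply (Θ : S ≃+* T) (h : ∀ s, Θ s ∈ Set.range (algebraMap B T) ↔
    s ∈ Set.range (algebraMap A S)) (φ : S ≃ₐ[A] S) (s : S) :
    conjMulEquiv Θ h φ (Θ s) = Θ (φ s) :=
  congrArg (fun t => Θ (φ t)) (Θ.symm_apply_apply s)

end Conjugation

section Comparison

variable {X Y E : Type*} [TopologicalSpace X] [TopologicalSpace Y] [TopologicalSpace E] {n : ℕ}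
  {p : C(Y, X)} {q : C(E, X)} {α : Fin n → C(Y, ℂ)} {β : Fin n → C(E, ℂ)}

theorem pullback_injective {π : C(Y, E)} (hπ : Function.Surjective π) :
    Function.Injective (pullback π) :=
  fun _ _ h => (ContinuousMap.cancel_right hπ).mp h

theorem toSubring_rootRing (p : C(Y, X)) (α : Fin n → C(Y, ℂ)) :
    (rootRing p α).toSubring = Subring.closure (Set.range (pullback p) ∪ Set.range α) := by
  rw [Algebra.adjoin_eq_ring_closure]
  congr 2
  exact Subtype.range_val

theorem map_pullback_rootRing (q : C(E, X)) (β : Fin n → C(E, ℂ)) (π : C(Y, E)) :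
    (rootRing q β).toSubring.map (pullback π) =
      (rootRing (q.comp π) fun i => (β i).comp π).toSubring := by
  rw [toSubring_rootRing, toSubring_rootRing, RingHom.map_closure, Set.image_union,
    ← Set.range_comp, ← Set.range_comp]
  rfl

theorem exists_rootRing_ringEquiv {π : C(Y, E)} (hπ : Function.Surjective π) (hq : q.comp π = p)
    {τ : Equiv.Perm (Fin n)} (hτ : ∀ i, (β i).comp π = α (τ i)) :
    ∃ Θ : rootRing q β ≃+* rootRing p α, ∀ s, (Θ s : C(Y, ℂ)) = (s : C(E, ℂ)).comp π := by
  have hmap : (rootRing q β).toSubring.map (pullback π) = (rootRing p α).toSubring := by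
    rw [map_pullback_rootRing, hq, funext hτ, toSubring_rootRing, toSubring_rootRing,
      ← EquivLike.range_comp α τ]
    rfl
  exact ⟨((rootRing q β).toSubring.equivMapOfInjective _ (pullback_injective hπ)).trans
    (.subringCongr hmap), fun _ => rfl⟩

theorem mem_range_algebraMap_iff {s : rootRing p α} :
    s ∈ Set.range (algebraMap (pullbackRing p) (rootRing p α)) ↔
      (s : C(Y, ℂ)) ∈ pullbackRing p :=
  ⟨fun ⟨r, hr⟩ => hr ▸ r.2, fun h => ⟨⟨s, h⟩, rfl⟩⟩

theorem pullback_mem_pullbackRing_iff {π : C(Y, E)} (hπ : Function.Surjective π) {g : C(E, ℂ)} :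
    pullback π g ∈ pullbackRing (q.comp π) ↔ g ∈ pullbackRing q :=
  exists_congr fun γ => (pullback_injective hπ).eq_iff (a := pullback q γ)

theorem exists_galoisGroup_mulEquiv {π : C(Y, E)} (hπ : Function.Surjective π)
    (hq : q.comp π = p) {Θ : rootRing q β ≃+* rootRing p α}
    (hΘ : ∀ s, (Θ s : C(Y, ℂ)) = (s : C(E, ℂ)).comp π) :
    ∃ ι : GaloisGroup q β ≃* GaloisGroup p α, ∀ φ s, ι φ (Θ s) = Θ (φ s) := by
  have hscalars (s : rootRing q β) :
      Θ s ∈ Set.range (algebraMap (pullbackRing p) (rootRing p α)) ↔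
        s ∈ Set.range (algebraMap (pullbackRing q) (rootRing q β)) := by
    rw [mem_range_algebraMap_iff, mem_range_algebraMap_iff, hΘ, ← hq]
    exact pullback_mem_pullbackRing_iff hπ
  exact ⟨conjMulEquiv Θ hscalars, conjMulEquiv_apply Θ hscalars⟩

theorem IsSplittingCovering.exists_surjective_comp_eq {X Y E : Type u} [TopologicalSpace X]
    [TopologicalSpace Y] [TopologicalSpace E] [PathConnectedSpace Y]
    {f : C(X, ℂ)[X]} {p : C(Y, X)} {q : C(E, X)} {α : Fin n → C(Y, ℂ)} {β : Fin n → C(E, ℂ)}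
    (hq : IsSplittingCovering f n q) (hf : IsWeierstrass f n) (hp : IsCoveringMap p)
    (hα : SplitsWithRoots (pullbackPoly p f) α) (hβ : SplitsWithRoots (pullbackPoly q f) β) :
    ∃ π : C(Y, E), Function.Surjective π ∧ q.comp π = p ∧
      ∃ τ : Equiv.Perm (Fin n), ∀ i, (β i).comp π = α (τ i) := by
  have := hq.pathConnected
  obtain ⟨π, hπ, hqπ⟩ := hq.smallest Y p hp ⟨α, hα⟩
  have hsurj := surjective_of_isCoveringMap hπ
  have hβπ := hβ.comp_of_surjective hsurj
  rw [pullbackPoly_pullbackPoly, hqπ] at hβπ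
  exact ⟨π, hsurj, hqπ, hα.exists_perm (hf.pullbackPoly p) hβπ⟩

end Comparison

end SemiTopGalois

open SemiTopGalois in
theorem mainTheorem2_general {X : Type u} [TopologicalSpace X] [PathConnectedSpace X]
    {n : ℕ} (f : Polynomial C(X, ℂ)) (hf : IsWeierstrass f n) :
    (∀ (Y : Type u) [TopologicalSpace Y] [PathConnectedSpace Y] (p : C(Y, X)),
      IsCoveringMap p → ∀ α : Fin n → C(Y, ℂ),
      SplitsWithRoots (pullbackPoly p f) α →
        (∃ g ∈ rootRing p α, ∀ y, Delta α y * g y = 1) ∧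
        IsCHRGalois (pullbackRing p) (rootRing p α) ⊤ ∧
        ∀ (E : Type u) [TopologicalSpace E] (q : C(E, X)),
          IsSplittingCovering f n q → ∀ β : Fin n → C(E, ℂ),
          SplitsWithRoots (pullbackPoly q f) β →
          ∃ (Θ : rootRing q β ≃+* rootRing p α)
            (ι : GaloisGroup q β ≃* GaloisGroup p α),
            (∀ (s : rootRing q β) (γ : C(X, ℂ)),
              (s : C(E, ℂ)) = γ.comp q → (Θ s : C(Y, ℂ)) = γ.comp p) ∧
            (∃ τ : Equiv.Perm (Fin n), ∀ (s : rootRing q β) (i : Fin n),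
              (s : C(E, ℂ)) = β i → (Θ s : C(Y, ℂ)) = α (τ i)) ∧
            ∀ φ s, ι φ (Θ s) = Θ (φ s)) ∧
    (∀ (E : Type u) [TopologicalSpace E] (q : C(E, X)),
      IsSplittingCovering f n q → ∀ β : Fin n → C(E, ℂ),
      SplitsWithRoots (pullbackPoly q f) β →
      ∃ ω : coveringTransformations q →* GaloisGroup q β,
        (∀ (Φ : coveringTransformations q) (s : rootRing q β) (e : E),
          (ω Φ s : C(E, ℂ)) e = (s : C(E, ℂ)) ((Φ : E ≃ₜ E)⁻¹ e)) ∧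
        Function.Surjective ω) := by
  refine ⟨fun Y _ _ p hp α hα => ⟨exists_mem_rootRing_Delta_mul_eq_one hf hp hα,
    isCHRGalois_rootRing hf hp hα, fun E _ q hq β hβ => ?_⟩, fun E _ q hq β hβ => ?_⟩
  · obtain ⟨π, hπ, hqπ, τ, hτ⟩ := hq.exists_surjective_comp_eq hf hp hα hβ
    obtain ⟨Θ, hΘ⟩ := exists_rootRing_ringEquiv hπ hqπ hτ
    obtain ⟨ι, hι⟩ := exists_galoisGroup_mulEquiv hπ hqπ hΘ
    refine ⟨Θ, ι, fun s γ hs => ?_, ⟨τ, fun s i hs => ?_⟩, hι⟩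
    · rw [hΘ, hs, ← hqπ, ContinuousMap.comp_assoc]
    · rw [hΘ, hs, hτ]
  · have := hq.pathConnected
    obtain ⟨ω, hω⟩ := exists_coveringTransformations_hom hf hβ
    exact ⟨ω, hω, hq.coveringTransformations_hom_surjective hf hβ hω⟩

theorem mainTheorem2 {X : Type u} [TopologicalSpace X] [PathConnectedSpace X]
    [LocallyPathConnectedSpace X]
    {n : ℕ} (f : Polynomial C(X, ℂ)) (hf : SemiTopGalois.IsWeierstrass f n) :
    (∀ (Y : Type u) [TopologicalSpace Y] [PathConnectedSpace Y] (p : C(Y, X)),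
      IsCoveringMap p → ∀ α : Fin n → C(Y, ℂ),
      SemiTopGalois.SplitsWithRoots (SemiTopGalois.pullbackPoly p f) α →
        -- `1 / Δ` lies in `R[α_1, …, α_n]`
        (∃ g ∈ SemiTopGalois.rootRing p α, ∀ y, SemiTopGalois.Delta α y * g y = 1) ∧
        -- `R[α_1, …, α_n]` is Galois over `R` with group all of `Aut_R(R[α_1, …, α_n])`
        SemiTopGalois.IsCHRGalois (SemiTopGalois.pullbackRing p) (SemiTopGalois.rootRing p α) ⊤ ∧
        -- and this group is `G_f`, by conjugation with an isomorphism of the rings of roots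
        ∀ (E : Type u) [TopologicalSpace E] (q : C(E, X)),
          SemiTopGalois.IsSplittingCovering f n q → ∀ β : Fin n → C(E, ℂ),
          SemiTopGalois.SplitsWithRoots (SemiTopGalois.pullbackPoly q f) β →
          ∃ (Θ : SemiTopGalois.rootRing q β ≃+* SemiTopGalois.rootRing p α)
            (ι : SemiTopGalois.GaloisGroup q β ≃* SemiTopGalois.GaloisGroup p α),
            (∀ (s : SemiTopGalois.rootRing q β) (γ : C(X, ℂ)),
              (s : C(E, ℂ)) = γ.comp q → (Θ s : C(Y, ℂ)) = γ.comp p) ∧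
            (∃ τ : Equiv.Perm (Fin n), ∀ (s : SemiTopGalois.rootRing q β) (i : Fin n),
              (s : C(E, ℂ)) = β i → (Θ s : C(Y, ℂ)) = α (τ i)) ∧
            ∀ φ s, ι φ (Θ s) = Θ (φ s)) ∧
    -- `ω : A(E_f/X) → G_f`, `ω(Φ)(s) = s ∘ Φ⁻¹`, is a surjective homomorphism
    (∀ (E : Type u) [TopologicalSpace E] (q : C(E, X)),
      SemiTopGalois.IsSplittingCovering f n q → ∀ β : Fin n → C(E, ℂ),
      SemiTopGalois.SplitsWithRoots (SemiTopGalois.pullbackPoly q f) β →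
      ∃ ω : SemiTopGalois.coveringTransformations q →* SemiTopGalois.GaloisGroup q β,
        (∀ (Φ : SemiTopGalois.coveringTransformations q) (s : SemiTopGalois.rootRing q β) (e : E),
          (ω Φ s : C(E, ℂ)) e = (s : C(E, ℂ)) ((Φ : E ≃ₜ E)⁻¹ e)) ∧
        Function.Surjective ω) :=
  mainTheorem2_general f hf
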